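/- **Setting.** Consider a finite dynamic game with complete information and perfect recall, without chance moves (simultaneous moves are allowed), with finite player set $I$, information sets $H_i$, finite nonempty strategy sets $S_i$ (maps from information sets in $H_i$ to available actions), terminal histories $Z$, outcome map $\zeta:S=\prod_i S_i\to Z$, and payoffs $u_i:Z\to\mathbb R$. For an information set $h$ (of any player), $S_j(h)$ is the set of strategies $s_j$ such that some profile $s=(s_j,s_{-j})$ has a history of $h$ strictly preceding $\zeta(s)$. For $h\in H_i$, $S_{-i}(h)$ is $\prod_{j\ne i}S_j(h)$; the result holds as well if $S_{-i}(h)$ is instead, throughout, the set of those $s_{-i}$ for which some $(s_i,s_{-i})$ passes through $h$. A *conditional probability system* (CPS) on a measurable space $\Omega$ with conditioning events $(C_h)_{h\in H_i}$ is a family of probability measures $\mu(\cdot|h)$ with $\mu(C_h|h)=1$ and $\mu(E|h)\,\mu(C_h|h')=\mu(E|h')$ for all measurable $E\subseteq C_h\subseteq C_{h'}$. Sets of CPS's carry the product of the topologies of weak convergence. Let $\Delta^{H_i}(S_{-i})$ be the set of CPS's on $S_{-i}$ with conditioning events $S_{-i}(h)$, $h\in H_i$. Such a $\mu_i$ *strongly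 believes* $\bar S_j\subseteq S_j$ ($j\neq i$) if $\mu_i(\bar S_j\times\prod_{k\ne i,j}S_k\,|\,h)=1$ for all $h\in H_i$ with $\bar S_j\cap S_j(h)\ne\emptyset$. Let $\rho(\mu_i)$ be the set of sequential best replies: those $s_i$ such that, for each $h\in H_i$ with $s_i\in S_i(h)$, $s_i$ maximizes $\sum_{s_{-i}\in S_{-i}(h)}u_i(\zeta(\cdot,s_{-i}))\mu_i(s_{-i}|h)$ over $S_i(h)$. *Rationalizability*: $S_i^0=S_i$; for $n>0$, $s_i\in S_i^n$ iff $s_i\in\rho(\mu_i)$ for some $\mu_i\in\Delta^{H_i}(S_{-i})$ that strongly believes $S_j^q$ for all $j\ne i$ and $q<n$; $S_i^\infty=\bigcap_n S_i^n$. Let $\Delta_i\subseteq\Delta^{H_i}(S_{-i})$ for each $i$. *Selective Rationalizability*: $S_{i,R\Delta}^0=S_i^\infty$; for $n>0$, $s_i\in S_{i,R\Delta}^n$ iff $s_i\in\rho(\mu_i)$ for some $\mu_i\in\Delta_i$ that strongly believes $S_{j,R\Delta}^q$ for all $j\neq i$, $q<n$, and $S_j^q$ for all $j\ne i$, $q\ge0$;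 $S_{i,R\Delta}^\infty=\bigcap_n S_{i,R\Delta}^n$. Write $S^n=\prod_iS_i^n$, $S^n_{R\Delta}=\prod_i S^n_{i,R\Delta}$, and similarly for $n=\infty$. A *compact, complete, continuous type structure* consists of nonempty compact metrizable spaces $T_i$ and continuous onto maps $g_i=(g_{i,h})_{h\in H_i}$ from $T_i$ to the space of CPS's on $\Omega_{-i}=\prod_{j\ne i}\Omega_j$, $\Omega_j=S_j\times T_j$ (Borel $\sigma$-algebra), with conditioning events $T_{-i}\times S_{-i}(h)$, $h\in H_i$. Let $f_i(t_i)$ be the CPS of marginals on $S_{-i}$ of $g_i(t_i)$. Put $[\Delta_i]=\{(s_i,t_i)\in\Omega_i:f_i(t_i)\in\Delta_i\}$, $[\Delta]=\prod_i[\Delta_i]$, $R_i=\{(s_i,t_i)\in\Omega_i:s_i\in\rho(f_i(t_i))\}$, $R=\prod_iR_i$. For a Cartesian event $E=\prod_iE_i\subseteq\prod_i\Omega_i$, let $SB_i(E_{-i})$ be the set of $(s_i,t_i)\in\Omega_i$ such that for every $j\ne i$, $g_{i,h}(t_i)(E_j\times\prod_{k\ne i,j}\Omega_k)=1$ for all $h\in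 H_i$ with $\mathrm{Proj}_{S_{-i}}(E_j\times\prod_{k\ne i,j}\Omega_k)\cap S_{-i}(h)\neq\emptyset$. Let $CSB(E)=\prod_i(E_i\cap SB_i(E_{-i}))$, $CSB^0(E)=E$, $CSB^{n+1}(E)=CSB(CSB^n(E))$, $CSB^\infty(E)=\bigcap_{n\ge0}CSB^n(E)$. **Theorem.** Fix a compact, complete, continuous type structure and compact sets $\Delta_i\subseteq\Delta^{H_i}(S_{-i})$, $i\in I$. Then for every $n\ge0$ $$S_{R\Delta}^{n+1}=\mathrm{Proj}_S\,CSB^n\big([\Delta]\cap CSB^\infty(R)\big),\qquad\text{and}\qquad S_{R\Delta}^{\infty}=\mathrm{Proj}_S\,CSB^\infty\big([\Delta]\cap CSB^\infty(R)\big).$$ Moreover $S^{n+1}=\mathrm{Proj}_S\,CSB^n(R)$ for every $n\ge0$, and $S^\infty=\mathrm{Proj}_S\,CSB^\infty(R)$. -/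

import Mathlib

open MeasureTheory Set

universe u v w

noncomputable section

/-- A compact metrizable space is second countable. -/
instance secondCountable_of_compact_metrizable (X : Type*) [TopologicalSpace X] [CompactSpace X]
    [TopologicalSpace.MetrizableSpace X] : SecondCountableTopology X := by
  let _ := TopologicalSpace.metrizableSpaceMetric X
  infer_instance

/-! ### Finite dynamic games -/

/-- A finite dynamic game with complete information and perfect recall and without chance moves.
The histories form a finite tree. At a history several players may be active simultaneously;
`info i x = some h` says that player `i` is active at the history `x` and that `x` belongs to her
information set `h`; a history is terminal when nobody is active at it. At a non-terminal history
`x`, each profile of available actions of the active players leads to its own immediate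
successor. -/
structure DynamicGame (I : Type u) where
  /-- histories -/
  Node : Type v
  finite_node : Finite Node
  /-- the initial history -/
  root : Node
  /-- information sets of each player -/
  H : I → Type v
  finite_H : ∀ i, Finite (H i)
  /-- available actions at an information set -/
  A : ∀ i, H i → Type v
  finite_A : ∀ i h, Finite (A i h)
  nonempty_A : ∀ i h, Nonempty (A i h)
  info : ∀ i, Node → Option (H i)
  /-- information sets are nonempty -/
  info_surj : ∀ i h, ∃ x, info i x = some h
  /-- the immediate successor of a non-terminal history after a profile of actions of the
  active players -/
  next : ∀ x : Node, (∃ i h, info i x = some h) → (∀ i h, info i x = some h → A i h) → Node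
  next_ne_root : ∀ x hx a, next x hx a ≠ root
  /-- a history determines its immediate predecessor and the actions leading from there to it -/
  next_inj : ∀ x hx a y hy b, next x hx a = next y hy b →
    x = y ∧ ∀ i h (h₁ : info i x = some h) (h₂ : info i y = some h), a i h h₁ = b i h h₂
  reachable : ∀ x, Relation.ReflTransGen (fun y z => ∃ hy a, next y hy a = z) root x
  /-- perfect recall: any two histories in the same information set `h` of `i` are preceded by
  the same information sets of `i`, with the same action of `i` taken there -/
  perfect_recall : ∀ i h x y, info i x = some h → info i y = some h →
    ∀ x' h' (hx' : info i x' = some h') (a : ∀ j k, info j x' = some k → A j k),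
      Relation.ReflTransGen (fun y z => ∃ hy b, next y hy b = z) (next x' ⟨i, h', hx'⟩ a) x →
      ∃ y', ∃ hy' : info i y' = some h', ∃ b : ∀ j k, info j y' = some k → A j k,
        Relation.ReflTransGen (fun y z => ∃ hy b, next y hy b = z) (next y' ⟨i, h', hy'⟩ b) y ∧
        b i h' hy' = a i h' hx'
  /-- payoffs, defined on terminal histories -/
  payoff : I → {z : Node // ∀ i, info i z = none} → ℝ

namespace DynamicGame

variable {I : Type u} (G : DynamicGame.{u, v} I)

instance : Finite G.Node := G.finite_node

instance (i : I) : Finite (G.H i) := G.finite_H i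

instance (i : I) (h : G.H i) : Finite (G.A i h) := G.finite_A i h

instance (i : I) (h : G.H i) : Nonempty (G.A i h) := G.nonempty_A i h

/-- Terminal histories. -/
abbrev Z : Type v := {z : G.Node // ∀ i, G.info i z = none}

/-- The strict precedence relation between histories. -/
def Prec : G.Node → G.Node → Prop :=
  Relation.TransGen (fun x y => ∃ hx a, G.next x hx a = y)

/-- Strategies of player `i`. -/
def Strategy (i : I) : Type v := ∀ h : G.H i, G.A i h

instance (i : I) : Finite (G.Strategy i) := inferInstanceAs (Finite (∀ h : G.H i, G.A i h))

instance (i : I) : Nonempty (G.Strategy i) := inferInstanceAs (Nonempty (∀ h : G.H i, G.A i h))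

instance (i : I) : TopologicalSpace (G.Strategy i) := ⊥

instance (i : I) : DiscreteTopology (G.Strategy i) := ⟨rfl⟩

instance (i : I) : MeasurableSpace (G.Strategy i) := ⊤

instance (i : I) : DiscreteMeasurableSpace (G.Strategy i) := ⟨fun _ => trivial⟩

/-- Strategy profiles. -/
abbrev Profile : Type (max u v) := ∀ i, G.Strategy i

/-- Strategy profiles of the opponents of `i`. -/
abbrev OppProfile (i : I) : Type (max u v) := ∀ j : {j // j ≠ i}, G.Strategy j

instance [Finite I] (i : I) : Fintype (G.OppProfile i) := Fintype.ofFinite _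

open Classical in
/-- One step of play according to a strategy profile; play stays at terminal histories. -/
def step (s : G.Profile) (x : G.Node) : G.Node :=
  if hx : ∃ i h, G.info i x = some h then G.next x hx (fun i h _ => s i h) else x

theorem exists_terminal (s : G.Profile) : ∃ n, ∀ i, G.info i ((G.step s)^[n] G.root) = none := by
  by_contra! hcon
  have hact : ∀ n, ∃ i h, G.info i ((G.step s)^[n] G.root) = some h := by
    intro n
    obtain ⟨i, hi⟩ := hcon n
    exact ⟨i, Option.ne_none_iff_exists'.1 hi⟩
  have hsucc : ∀ n, (G.step s)^[n + 1] G.root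
      = G.next ((G.step s)^[n] G.root) (hact n) (fun i h _ => s i h) := by
    intro n
    rw [Function.iterate_succ_apply']
    exact dif_pos (hact n)
  have hinj : ∀ m n, (G.step s)^[m] G.root = (G.step s)^[n] G.root → m = n := by
    intro m
    induction m with
    | zero =>
      intro n hn
      cases n with
      | zero => rfl
      | succ n =>
        rw [hsucc n] at hn
        exact absurd hn.symm (G.next_ne_root _ _ _)
    | succ m ih =>
      intro n hn
      cases n with
      | zero =>
        rw [hsucc m] at hn
        exact absurd hn (G.next_ne_root _ _ _)
      | succ n =>
        rw [hsucc m, hsucc n] at hn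
        rw [ih n (G.next_inj _ _ _ _ _ _ hn).1]
  exact not_injective_infinite_finite (fun n => (G.step s)^[n] G.root) (fun m n h => hinj m n h)

open Classical in
/-- The terminal history induced by a strategy profile. -/
def outcome (s : G.Profile) : G.Z :=
  ⟨(G.step s)^[Nat.find (G.exists_terminal s)] G.root, Nat.find_spec (G.exists_terminal s)⟩

/-- The set of histories that make up an information set. -/
def histories {i : I} (h : G.H i) : Set G.Node := {x | G.info i x = some h}

/-- `S_j(h)`: the strategies of player `j` that allow to reach the information set `h`
(of some player `i`). -/
def reach (j : I) {i : I} (h : G.H i) : Set (G.Strategy j) :=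
  {sj | ∃ s : G.Profile, s j = sj ∧ ∃ x ∈ G.histories h, G.Prec x (G.outcome s)}

variable [DecidableEq I]

/-- The profile `(s_i, s_{-i})`. -/
def join {i : I} (si : G.Strategy i) (so : G.OppProfile i) : G.Profile :=
  (Equiv.piSplitAt i G.Strategy).symm (si, so)

end DynamicGame

/-- Two conventions for the set `S_{-i}(h)` of opponents' strategy profiles that player `i`
observes at her information set `h`. They agree whenever the strategies that allow to reach `h`
form a Cartesian product, in particular in two-player games and in games with observable
actions. -/
inductive Observation
  /-- `S_{-i}(h)` is the Cartesian product of the sets `S_j(h)` over the opponents `j` -/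
  | cartesian
  /-- `S_{-i}(h)` is the set of opponents' profiles that jointly allow to reach `h` -/
  | joint

namespace DynamicGame

variable {I : Type u} [DecidableEq I] (G : DynamicGame.{u, v} I) (obs : Observation)

/-- `S_{-i}(h)`, for an information set `h` of player `i`. -/
def oppReach (i : I) (h : G.H i) : Set (G.OppProfile i) :=
  match obs with
  | .cartesian => {so | ∀ j : {j // j ≠ i}, so j ∈ G.reach j.1 h}
  | .joint => {so | ∃ si : G.Strategy i, ∃ x ∈ G.histories h, G.Prec x (G.outcome (G.join si so))}

end DynamicGame

/-! ### Conditional probability systems -/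

/-- The axioms of a conditional probability system on `Ω` with conditioning events
`C k`, `k : κ`. (For `C k = C l` they force `μ k = μ l`, so that indexing by `k` instead of the
event `C k` makes no difference.) -/
structure IsCPS {κ Ω : Type*} [MeasurableSpace Ω] (C : κ → Set Ω)
    (μ : κ → ProbabilityMeasure Ω) : Prop where
  self : ∀ k, μ k (C k) = 1
  chain : ∀ k l (E : Set Ω), MeasurableSet E → E ⊆ C k → C k ⊆ C l →
    μ k E * μ l (C k) = μ l E

/-- Conditional probability systems on `Ω` with conditioning events `C k`. When `Ω` carries a
topology, this is a subspace of the product of the spaces of probability measures with the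
topology of weak convergence. -/
abbrev CPS {κ Ω : Type*} [MeasurableSpace Ω] (C : κ → Set Ω) : Type _ :=
  {μ : κ → ProbabilityMeasure Ω // IsCPS C μ}

/-- The image of a conditional probability system under a measurable map. -/
def CPS.map {κ Ω Ω' : Type*} [MeasurableSpace Ω] [MeasurableSpace Ω'] {p : Ω → Ω'}
    (hp : Measurable p) {C : κ → Set Ω'} (hC : ∀ k, MeasurableSet (C k))
    (μ : CPS (fun k => p ⁻¹' C k)) : CPS C :=
  ⟨fun k => (μ.1 k).map hp.aemeasurable, by
    have key : ∀ k (E : Set Ω'), MeasurableSet E →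
        (μ.1 k).map hp.aemeasurable E = μ.1 k (p ⁻¹' E) := fun k E hE =>
      ProbabilityMeasure.map_apply _ hp.aemeasurable hE
    refine ⟨fun k => ?_, fun k l E hE hEk hkl => ?_⟩
    · rw [key k _ (hC k)]
      exact μ.2.self k
    · rw [key k E hE, key l _ (hC k), key l E hE]
      exact μ.2.chain k l _ (hp hE) (preimage_mono hEk) (preimage_mono hkl)⟩

namespace DynamicGame

/-! ### State spaces -/

variable {I : Type u} (G : DynamicGame.{u, v} I) (T : I → Type w)

/-- `Ω_i = S_i × T_i`. -/
abbrev State (i : I) : Type (max v w) := G.Strategy i × T i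

/-- `Ω_{-i}`. -/
abbrev OppState (i : I) : Type (max u v w) := ∀ j : {j // j ≠ i}, G.State T j

variable {G T} in
/-- The projection of `Ω_{-i}` on `S_{-i}`. -/
def oppStrategies {i : I} (ω : G.OppState T i) : G.OppProfile i := fun j => (ω j).1

theorem measurable_oppStrategies [∀ i, MeasurableSpace (T i)] (i : I) :
    Measurable (oppStrategies : G.OppState T i → G.OppProfile i) :=
  measurable_pi_lambda _ fun j => measurable_fst.comp (measurable_pi_apply j)

end DynamicGame

namespace DynamicGame

variable {I : Type u} [Finite I] [DecidableEq I] (G : DynamicGame.{u, v} I) (obs : Observation)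

/-! ### First-order beliefs, sequential best replies, and the solution concepts -/

/-- The conditional probability systems of player `i` over the opponents' strategies. -/
abbrev StratCPS (i : I) : Type _ := CPS (G.oppReach obs i)

variable {G obs}

/-- Player `i`'s system `μ` strongly believes the set `Sj` of strategies of the opponent `j`. -/
def StronglyBelieves {i : I} (μ : G.StratCPS obs i) (j : {j // j ≠ i})
    (Sj : Set (G.Strategy j)) : Prop :=
  ∀ h : G.H i, (Sj ∩ G.reach (j : I) h).Nonempty → μ.1 h {so | so j ∈ Sj} = 1

open Classical in
/-- The expected payoff of the strategy `si` under the belief held at `h`. -/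
def expectedPayoff {i : I} (μ : G.StratCPS obs i) (h : G.H i) (si : G.Strategy i) : ℝ :=
  ∑ so : G.OppProfile i with so ∈ G.oppReach obs i h,
    G.payoff i (G.outcome (G.join si so)) * (μ.1 h {so} : ℝ)

/-- The sequential best replies to `μ`. -/
def bestReplies {i : I} (μ : G.StratCPS obs i) : Set (G.Strategy i) :=
  {si | ∀ h : G.H i, si ∈ G.reach i h →
    ∀ si' ∈ G.reach i h, expectedPayoff μ h si' ≤ expectedPayoff μ h si}

variable (G obs)

/-- The steps `S_i^n` of Rationalizability. -/
def rat : ℕ → ∀ i, Set (G.Strategy i)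
  | 0 => fun _ => univ
  | n + 1 => fun i => {si | ∃ μ : G.StratCPS obs i, si ∈ bestReplies μ ∧
      ∀ (j : {j // j ≠ i}) (q : Fin (n + 1)), StronglyBelieves μ j (rat q j)}
  termination_by n => n
  decreasing_by exact q.2

/-- `S_i^∞`. -/
def ratInf (i : I) : Set (G.Strategy i) := ⋂ n, G.rat obs n i

variable {G obs}

/-- The steps `S_{i,RΔ}^n` of Selective Rationalizability under the restrictions `Δ`. -/
def selRat (Δ : ∀ i, Set (G.StratCPS obs i)) : ℕ → ∀ i, Set (G.Strategy i)
  | 0 => fun i => G.ratInf obs i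
  | n + 1 => fun i => {si | ∃ μ ∈ Δ i, si ∈ bestReplies μ ∧
      (∀ (j : {j // j ≠ i}) (q : Fin (n + 1)), StronglyBelieves μ j (selRat Δ q j)) ∧
      ∀ (j : {j // j ≠ i}) (q : ℕ), StronglyBelieves μ j (G.rat obs q j)}
  termination_by n => n
  decreasing_by exact q.2

/-- `S_{i,RΔ}^∞`. -/
def selRatInf (Δ : ∀ i, Set (G.StratCPS obs i)) (i : I) : Set (G.Strategy i) :=
  ⋂ n, selRat Δ n i

/-! ### Belief maps and belief operators -/

variable (G obs) (T : I → Type w) [∀ i, MeasurableSpace (T i)]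

/-- The conditional probability systems of player `i` over the opponents' strategies and types,
with conditioning events `T_{-i} × S_{-i}(h)`. -/
abbrev StateCPS (i : I) : Type _ :=
  CPS (fun h : G.H i => (oppStrategies ⁻¹' G.oppReach obs i h : Set (G.OppState T i)))

variable {G obs T}

/-- The first-order belief map `f_i`. -/
def firstOrder (g : ∀ i, T i → G.StateCPS obs T i) (i : I) (t : T i) : G.StratCPS obs i :=
  CPS.map (G.measurable_oppStrategies T i) (fun _ => (Set.toFinite _).measurableSet) (g i t)

/-- The event `[Δ_i]`. -/
def restriction (g : ∀ i, T i → G.StateCPS obs T i) (Δ : ∀ i, Set (G.StratCPS obs i)) (i : I) :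
    Set (G.State T i) :=
  {ω | firstOrder g i ω.2 ∈ Δ i}

/-- The event `R_i` that player `i` is rational. -/
def rational (g : ∀ i, T i → G.StateCPS obs T i) (i : I) : Set (G.State T i) :=
  {ω | ω.1 ∈ bestReplies (firstOrder g i ω.2)}

/-- `B_{i,h}(F)` for an event `F` in `Ω_{-i}`. -/
def believes (g : ∀ i, T i → G.StateCPS obs T i) (i : I) (h : G.H i) (F : Set (G.OppState T i)) :
    Set (G.State T i) :=
  {ω | (g i ω.2).1 h F = 1}

/-- The strong belief operator, for an event `F` in `Ω_{-i}`. -/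
def strongBelief (g : ∀ i, T i → G.StateCPS obs T i) (i : I) (F : Set (G.OppState T i)) :
    Set (G.State T i) :=
  ⋂ (h : G.H i) (_ : (oppStrategies '' F ∩ G.oppReach obs i h).Nonempty), believes g i h F

/-- The independent strong belief operator `SB_i`. -/
def indepStrongBelief (g : ∀ i, T i → G.StateCPS obs T i) (E : ∀ i, Set (G.State T i)) (i : I) :
    Set (G.State T i) :=
  ⋂ j : {j // j ≠ i}, strongBelief g i {ω | ω j ∈ E j}

/-- `CSB`, acting on the factors of a Cartesian event. -/
def csb (g : ∀ i, T i → G.StateCPS obs T i) (E : ∀ i, Set (G.State T i)) (i : I) :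
    Set (G.State T i) :=
  E i ∩ indepStrongBelief g E i

/-- `CSB^n`. -/
def csbIter (g : ∀ i, T i → G.StateCPS obs T i) (n : ℕ) (E : ∀ i, Set (G.State T i)) :
    ∀ i, Set (G.State T i) :=
  (csb g)^[n] E

/-- `CSB^∞`. -/
def csbInf (g : ∀ i, T i → G.StateCPS obs T i) (E : ∀ i, Set (G.State T i)) (i : I) :
    Set (G.State T i) :=
  ⋂ n, csbIter g n E i

/-- `Proj_S` of the Cartesian event with factors `E i`. -/
def projStrategies (E : ∀ i, Set (G.State T i)) : Set G.Profile :=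
  (fun (ω : ∀ i, G.State T i) (i : I) => (ω i).1) '' Set.pi univ E

end DynamicGame

end

/-! All events are Cartesian, so each factor can be projected separately, by strong induction on
`n`. From states to strategies, the first-order belief of the type at hand is the justifying system,
because strong belief passes to marginals (`stronglyBelieves_of_mem_indepStrongBelief`).

Conversely, given a justifying `μ`, attach to every opponent strategy `s_j` one type `τ j s_j` and
push `μ` forward along `s_j ↦ (s_j, τ j s_j)` in every coordinate; completeness yields a type with
these beliefs (`exists_type_of_stratCPS`). A single type per strategy must serve all levels `q`, so
it is taken from the deepest event of the decreasing chain in which the strategy survives. For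
strategies that survive forever this needs compactness: the events are closed (`isClosed_csbIter`),
so the nested nonempty fibres have a common point (`exists_forall_mem_of_antitone`). The same fact
lets projection commute with the intersections defining the limits.

Under the restrictions `Δ`, the type must serve two chains, starting from `R` and from `[Δ] ∩
CSB^∞(R)`. This is possible because the second lies inside every event of the first. -/

open Filter Topology

/-! ### Weak limits and compact fibres. -/

/-- Portmanteau: a closed set cannot lose mass in a weak limit. -/
theorem MeasureTheory.ProbabilityMeasure.isClosed_setOf_apply_eq_one {Ω : Type*}
    [MeasurableSpace Ω] [TopologicalSpace Ω] [OpensMeasurableSpace Ω] [HasOuterApproxClosed Ω]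
    {F : Set Ω} (hF : IsClosed F) : IsClosed {μ : ProbabilityMeasure Ω | μ F = 1} := by
  have hcoe : ∀ μ : ProbabilityMeasure Ω, μ F = 1 ↔ (μ : Measure Ω) F = 1 := fun μ => by
    rw [← ProbabilityMeasure.ennreal_coeFn_eq_coeFn_toMeasure, ENNReal.coe_eq_one]
  refine isClosed_of_closure_subset fun μ hμ => ?_
  have : (𝓝[{μ : ProbabilityMeasure Ω | μ F = 1}] μ).NeBot := mem_closure_iff_nhdsWithin_neBot.1 hμ
  have hlim := ProbabilityMeasure.limsup_measure_closed_le_of_tendsto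
    (tendsto_id.mono_left (nhdsWithin_le_nhds (a := μ)
      (s := {μ : ProbabilityMeasure Ω | μ F = 1}))) hF
  have hev : ∀ᶠ ν in 𝓝[{μ : ProbabilityMeasure Ω | μ F = 1}] μ,
      ((id ν : ProbabilityMeasure Ω) : Measure Ω) F = 1 :=
    eventually_mem_nhdsWithin.mono fun ν hν => (hcoe ν).1 hν
  rw [limsup_congr hev, limsup_const] at hlim
  exact (hcoe μ).2 (le_antisymm prob_le_one hlim)

theorem MeasureTheory.ProbabilityMeasure.apply_eq_one_mono {Ω : Type*} [MeasurableSpace Ω]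
    {μ : ProbabilityMeasure Ω} {A B : Set Ω} (hAB : A ⊆ B) (hA : μ A = 1) : μ B = 1 :=
  le_antisymm (μ.apply_le_one B) (hA ▸ μ.apply_mono hAB)

/-- A point of a fibre that lies in as many members of a decreasing sequence of closed sets
as possible. -/
theorem exists_forall_mem_of_antitone {S T : Type*} [TopologicalSpace S] [TopologicalSpace T]
    [CompactSpace T] [Nonempty T] {F : ℕ → Set (S × T)} (hF : Antitone F)
    (hcl : ∀ n, IsClosed (F n)) (s : S) :
    ∃ t, ∀ n, s ∈ Prod.fst '' F n → (s, t) ∈ F n := by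
  by_cases hall : ∀ n, s ∈ Prod.fst '' F n
  · have hclosed : ∀ n, IsClosed {t | (s, t) ∈ F n} := fun n =>
      (hcl n).preimage (Continuous.prodMk_right s)
    obtain ⟨t, ht⟩ := IsCompact.nonempty_iInter_of_sequence_nonempty_isCompact_isClosed
      (fun n => {t | (s, t) ∈ F n}) (fun n t ht => hF n.le_succ ht)
      (fun n => by
        obtain ⟨⟨_, t⟩, ht, rfl⟩ := hall n
        exact ⟨t, ht⟩)
      (hclosed 0).isCompact hclosed
    exact ⟨t, fun n _ => mem_iInter.1 ht n⟩
  · classical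
    push Not at hall
    have hspec := Nat.find_spec hall
    rcases hk : Nat.find hall with _ | k <;> rw [hk] at hspec
    -- The first failure is at index 0, so no condition is ever active and any `t` will do; below,
    -- `t` comes from `k`, the last index at which `s` survives.
    · refine ⟨Classical.arbitrary T, fun n hn => ?_⟩
      exact absurd (image_mono (hF n.zero_le) hn) hspec
    · obtain ⟨⟨_, t⟩, ht, rfl⟩ := not_not.1 (Nat.find_min hall (m := k) (by lia))
      refine ⟨t, fun n hn => hF ?_ ht⟩
      by_contra! hlt
      exact absurd (image_mono (hF hlt) hn) hspec

theorem image_fst_iInter_of_antitone {S T : Type*} [TopologicalSpace S] [TopologicalSpace T]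
    [CompactSpace T] [Nonempty T] {F : ℕ → Set (S × T)} (hF : Antitone F)
    (hcl : ∀ n, IsClosed (F n)) : Prod.fst '' ⋂ n, F n = ⋂ n, Prod.fst '' F n := by
  refine (image_iInter_subset _ _).antisymm fun s hs => ?_
  obtain ⟨t, ht⟩ := exists_forall_mem_of_antitone hF hcl s
  exact ⟨(s, t), mem_iInter.2 fun n => ht n (mem_iInter.1 hs n), rfl⟩

namespace DynamicGame

/-! ### Projections on strategies and the two conventions for `S_{-i}(h)`. -/

section Projection

variable {I : Type u} {G : DynamicGame.{u, v} I} {T : I → Type w}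

theorem projStrategies_eq_pi (E : ∀ i, Set (G.State T i)) :
    projStrategies E = Set.pi univ fun i => Prod.fst '' E i := by
  ext s
  constructor
  · rintro ⟨ω, hω, rfl⟩ i -
    exact ⟨ω i, hω i trivial, rfl⟩
  · intro hs
    choose ω hω hs using fun i => hs i trivial
    exact ⟨ω, fun i _ => hω i, funext hs⟩

theorem continuous_oppStrategies [∀ i, TopologicalSpace (T i)] (i : I) :
    Continuous (oppStrategies : G.OppState T i → G.OppProfile i) :=
  continuous_pi fun j => continuous_fst.comp (continuous_apply j)

end Projection

variable {I : Type u} [DecidableEq I] {G : DynamicGame.{u, v} I} {obs : Observation}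

theorem mem_reach_of_mem_oppReach {i : I} {h : G.H i} {so : G.OppProfile i}
    (hso : so ∈ G.oppReach obs i h) (j : {j // j ≠ i}) : so j ∈ G.reach j.1 h := by
  cases obs with
  | cartesian => exact hso j
  | joint =>
    obtain ⟨si, x, hx, hprec⟩ := hso
    refine ⟨G.join si so, ?_, x, hx, hprec⟩
    exact congrFun (congrArg Prod.snd ((Equiv.piSplitAt i G.Strategy).apply_symm_apply (si, so))) j

/-- With `mem_reach_of_mem_oppReach`, this says that `S_{-i}(h)` projects onto `S_j(h)`. The rest of
the argument never distinguishes the two conventions. -/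
theorem exists_mem_oppReach_apply_eq {i : I} {h : G.H i} (hne : (G.oppReach obs i h).Nonempty)
    (j : {j // j ≠ i}) {sj : G.Strategy j} (hsj : sj ∈ G.reach j.1 h) :
    ∃ so ∈ G.oppReach obs i h, so j = sj := by
  cases obs with
  | cartesian =>
    obtain ⟨so, hso⟩ := hne
    refine ⟨Function.update so j sj, fun k => ?_, Function.update_self ..⟩
    rcases eq_or_ne k j with rfl | hk
    · rwa [Function.update_self]
    · rw [Function.update_of_ne hk]
      exact hso k
  | joint =>
    obtain ⟨s, rfl, x, hx, hprec⟩ := hsj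
    refine ⟨fun k => s k, ⟨s i, x, hx, ?_⟩, rfl⟩
    have hjoin : G.join (s i) (fun k => s k) = s :=
      (Equiv.piSplitAt i G.Strategy).symm_apply_apply s
    rwa [hjoin]

/-- Matches the activation condition in `SB_i`, stated with `S_{-i}(h)`, to that of strong belief in
strategies, stated with `S_j(h)`. -/
theorem oppStrategies_image_inter_oppReach_nonempty_iff {T : I → Type w} [∀ i, Nonempty (T i)]
    {i : I} {h : G.H i} (hne : (G.oppReach obs i h).Nonempty) (j : {j // j ≠ i})
    (E : Set (G.State T j)) :
    (oppStrategies '' {ω : G.OppState T i | ω j ∈ E} ∩ G.oppReach obs i h).Nonempty ↔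
      (Prod.fst '' E ∩ G.reach j.1 h).Nonempty := by
  constructor
  · rintro ⟨_, ⟨ω, hω, rfl⟩, hreach⟩
    exact ⟨(ω j).1, ⟨ω j, hω, rfl⟩, mem_reach_of_mem_oppReach hreach j⟩
  · rintro ⟨_, ⟨e, he, rfl⟩, hreach⟩
    obtain ⟨so, hso, hj⟩ := exists_mem_oppReach_apply_eq hne j hreach
    refine ⟨so, ⟨Function.update (fun k => (so k, Classical.arbitrary (T k))) j e, ?_, ?_⟩, hso⟩
    · simpa only [mem_ofPred_eq, Function.update_self] using he
    · funext k
      rcases eq_or_ne k j with rfl | hk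
      · simp only [oppStrategies, Function.update_self, hj]
      · simp only [oppStrategies, Function.update_of_ne hk]

theorem StratCPS.nonempty_oppReach {i : I} (μ : G.StratCPS obs i) (h : G.H i) :
    (G.oppReach obs i h).Nonempty := by
  by_contra hempty
  have hself := μ.2.self h
  rw [not_nonempty_iff_eq_empty.1 hempty, ProbabilityMeasure.coeFn_empty] at hself
  exact zero_ne_one hself

theorem stronglyBelieves_univ {i : I} (μ : G.StratCPS obs i) (j : {j // j ≠ i}) :
    StronglyBelieves μ j univ := fun _ _ =>
  ProbabilityMeasure.coeFn_univ _

/-! ### The recursions, and closedness of the best-reply condition. -/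

section Solution

variable [Finite I]

/-- Strong belief in `S_j^0` is vacuous; dropping it aligns the index with that of
`mem_csbIter_iff`. -/
theorem mem_rat_succ_iff {n : ℕ} {i : I} {si : G.Strategy i} :
    si ∈ G.rat obs (n + 1) i ↔ ∃ μ : G.StratCPS obs i, si ∈ bestReplies μ ∧
      ∀ (j : {j // j ≠ i}) (q : ℕ), q < n → StronglyBelieves μ j (G.rat obs (q + 1) j) := by
  rw [rat]
  refine exists_congr fun μ => and_congr_right fun _ => ⟨fun hμ j q hq => ?_, fun hμ j q => ?_⟩
  · exact hμ j ⟨q + 1, Nat.succ_lt_succ hq⟩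
  · obtain ⟨_ | q, hq⟩ := q
    · rw [rat]
      exact stronglyBelieves_univ μ j
    · exact hμ j q (Nat.lt_of_succ_lt_succ hq)

theorem mem_selRat_succ_iff {Δ : ∀ i, Set (G.StratCPS obs i)} {n : ℕ} {i : I}
    {si : G.Strategy i} :
    si ∈ selRat Δ (n + 1) i ↔ ∃ μ ∈ Δ i, si ∈ bestReplies μ ∧
      (∀ (j : {j // j ≠ i}) (q : ℕ), q < n + 1 → StronglyBelieves μ j (selRat Δ q j)) ∧
      ∀ (j : {j // j ≠ i}) (q : ℕ), StronglyBelieves μ j (G.rat obs q j) := by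
  rw [selRat]
  exact exists_congr fun μ => and_congr_right fun _ => and_congr_right fun _ =>
    and_congr_left fun _ => forall_congr' fun j => ⟨fun hμ q hq => hμ ⟨q, hq⟩, fun hμ q => hμ q q.2⟩

theorem rat_antitone (i : I) : Antitone fun n => G.rat obs n i := by
  refine antitone_nat_of_succ_le fun n => ?_
  cases n with
  | zero =>
    rw [rat]
    exact subset_univ _
  | succ n =>
    intro si hsi
    obtain ⟨μ, hμ, hbel⟩ := mem_rat_succ_iff.1 hsi
    exact mem_rat_succ_iff.2 ⟨μ, hμ, fun j q hq => hbel j q (hq.trans n.lt_succ_self)⟩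

/-- A decreasing sequence of subsets of a finite set stabilizes. Hence strong belief in all `S_j^q`
includes strong belief in `S_j^∞`. -/
theorem exists_rat_eq_ratInf (i : I) : ∃ n, G.rat obs n i = G.ratInf obs i := by
  obtain ⟨n, hn⟩ := WellFoundedGT.monotone_chain_condition
    (⟨fun n => OrderDual.toDual (G.rat obs n i), fun _ _ hmn => rat_antitone i hmn⟩ :
      ℕ →o (Set (G.Strategy i))ᵒᵈ)
  refine ⟨n, (subset_iInter fun m => ?_).antisymm (iInter_subset _ n)⟩
  rcases le_total n m with hnm | hmn
  · exact (congrArg OrderDual.ofDual (hn m hnm)).le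
  · exact rat_antitone i hmn

theorem continuous_expectedPayoff {i : I} (h : G.H i) (si : G.Strategy i) :
    Continuous fun μ : G.StratCPS obs i => expectedPayoff μ h si := by
  unfold expectedPayoff
  refine continuous_finsetSum _ fun so _ => continuous_const.mul <| NNReal.continuous_coe.comp ?_
  have hcont : Continuous fun ν : ProbabilityMeasure (G.OppProfile i) => ν {so} :=
    continuous_iff_continuousAt.2 fun ν =>
      -- Profiles form a discrete space, so singletons have empty frontier.
      ProbabilityMeasure.tendsto_measure_of_null_frontier_of_tendsto tendsto_id
        (by simp)
  exact hcont.comp ((continuous_apply h).comp continuous_subtype_val)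

theorem isClosed_setOf_mem_bestReplies {i : I} (si : G.Strategy i) :
    IsClosed {μ : G.StratCPS obs i | si ∈ bestReplies μ} := by
  have hinter : {μ : G.StratCPS obs i | si ∈ bestReplies μ} = ⋂ (h : G.H i) (_ : si ∈ G.reach i h)
      (si' : G.Strategy i) (_ : si' ∈ G.reach i h),
        {μ : G.StratCPS obs i | expectedPayoff μ h si' ≤ expectedPayoff μ h si} := by
    ext μ
    simp only [mem_iInter]
    rfl
  rw [hinter]
  exact isClosed_iInter fun h => isClosed_iInter fun _ => isClosed_iInter fun si' =>
    isClosed_iInter fun _ => isClosed_le (continuous_expectedPayoff h si')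
      (continuous_expectedPayoff h si)

end Solution

/-! ### Iterated strong belief, and the transfer of beliefs between strategies and states. -/

section TypeStructure

variable {T : I → Type w} [∀ i, MeasurableSpace (T i)] {g : ∀ i, T i → G.StateCPS obs T i}

theorem csbIter_succ (n : ℕ) (E : ∀ i, Set (G.State T i)) :
    csbIter g (n + 1) E = csb g (csbIter g n E) :=
  Function.iterate_succ_apply' _ _ _

theorem csbInf_subset_csbIter (n : ℕ) (E : ∀ i, Set (G.State T i)) (i : I) :
    csbInf g E i ⊆ csbIter g n E i :=
  iInter_subset _ n

theorem mem_csbIter_iff {n : ℕ} {E : ∀ i, Set (G.State T i)} {i : I} {ω : G.State T i} :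
    ω ∈ csbIter g n E i ↔
      ω ∈ E i ∧ ∀ q < n, ω ∈ indepStrongBelief g (csbIter g q E) i := by
  induction n with
  | zero => simp [csbIter]
  | succ n ih =>
    rw [csbIter_succ, csb, mem_inter_iff, ih, Nat.forall_lt_succ_right, and_assoc]

theorem csbIter_antitone (E : ∀ i, Set (G.State T i)) (i : I) :
    Antitone fun n => csbIter g n E i := fun _ _ hmn _ hω =>
  mem_csbIter_iff.2 ⟨(mem_csbIter_iff.1 hω).1, fun q hq =>
    (mem_csbIter_iff.1 hω).2 q (hq.trans_le hmn)⟩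

theorem mem_csbInf_iff {E : ∀ i, Set (G.State T i)} {i : I} {ω : G.State T i} :
    ω ∈ csbInf g E i ↔ ω ∈ E i ∧ ∀ q, ω ∈ indepStrongBelief g (csbIter g q E) i := by
  simp only [csbInf, mem_iInter, mem_csbIter_iff]
  exact ⟨fun hω => ⟨(hω 0).1, fun q => (hω (q + 1)).2 q q.lt_succ_self⟩,
    fun hω n => ⟨hω.1, fun q _ => hω.2 q⟩⟩

variable [Finite I]

section Belief

theorem mem_indepStrongBelief_iff [∀ i, Nonempty (T i)] {E : ∀ i, Set (G.State T i)} {i : I}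
    {ω : G.State T i} :
    ω ∈ indepStrongBelief g E i ↔ ∀ (j : {j // j ≠ i}) (h : G.H i),
      (Prod.fst '' E j ∩ G.reach j.1 h).Nonempty → (g i ω.2).1 h {ω' | ω' j ∈ E j} = 1 := by
  simp only [indepStrongBelief, strongBelief, mem_iInter, believes, mem_ofPred_eq]
  refine forall_congr' fun j => forall_congr' fun h => ?_
  rw [oppStrategies_image_inter_oppReach_nonempty_iff
    (StratCPS.nonempty_oppReach (firstOrder g i ω.2) h)]

theorem firstOrder_apply (i : I) (t : T i) (h : G.H i) (A : Set (G.OppProfile i)) :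
    (firstOrder g i t).1 h A = (g i t).1 h (oppStrategies ⁻¹' A) :=
  ProbabilityMeasure.map_apply _ (G.measurable_oppStrategies T i).aemeasurable
    (Set.toFinite A).measurableSet

theorem stronglyBelieves_of_mem_indepStrongBelief [∀ i, Nonempty (T i)]
    {E : ∀ i, Set (G.State T i)} {i : I} {ω : G.State T i} (hω : ω ∈ indepStrongBelief g E i)
    (j : {j // j ≠ i}) : StronglyBelieves (firstOrder g i ω.2) j (Prod.fst '' E j) := by
  intro h hne
  rw [firstOrder_apply]
  exact ProbabilityMeasure.apply_eq_one_mono (fun ω' hω' => ⟨ω' j, hω', rfl⟩)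
    (mem_indepStrongBelief_iff.1 hω j h hne)

/-- In a complete type structure, some type holds the first-order beliefs `μ` and is certain that
each opponent `j` with strategy `s_j` has type `τ j s_j`. -/
theorem exists_type_of_stratCPS (hg : ∀ i, Function.Surjective (g i)) {i : I}
    (μ : G.StratCPS obs i) (τ : ∀ j : {j // j ≠ i}, G.Strategy j → T j) :
    ∃ t : T i, firstOrder g i t = μ ∧ ∀ (h : G.H i) (F : Set (G.OppState T i)),
      μ.1 h {so | (fun j => (so j, τ j (so j))) ∈ F} = 1 → (g i t).1 h F = 1 := by
  let p : G.OppProfile i → G.OppState T i := fun so j => (so j, τ j (so j))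
  have hp : Measurable p := .of_discrete
  have hC : ∀ h : G.H i, MeasurableSet (oppStrategies ⁻¹' G.oppReach obs i h :
      Set (G.OppState T i)) := fun h =>
    G.measurable_oppStrategies T i (Set.toFinite _).measurableSet
  -- The conditioning events match definitionally, as `oppStrategies ∘ p` is the identity.
  obtain ⟨t, ht⟩ := hg i (CPS.map hp hC μ)
  have hval : ∀ h, (g i t).1 h = (μ.1 h).map hp.aemeasurable := fun h => by
    rw [ht]
    rfl
  refine ⟨t, Subtype.ext <| funext fun h => ?_, fun h F hF => ?_⟩
  · refine ProbabilityMeasure.eq_of_forall_apply_eq _ _ fun A hA => ?_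
    rw [firstOrder_apply, hval,
      ProbabilityMeasure.map_apply _ hp.aemeasurable (G.measurable_oppStrategies T i hA)]
    rfl
  · rw [hval]
    refine le_antisymm (ProbabilityMeasure.apply_le_one _ _) ?_
    rw [← hF, ← ENNReal.coe_le_coe, ProbabilityMeasure.ennreal_coeFn_eq_coeFn_toMeasure,
      ProbabilityMeasure.ennreal_coeFn_eq_coeFn_toMeasure]
    -- `F` need not be measurable; this inequality holds for every set and is enough.
    exact Measure.le_map_apply hp.aemeasurable F

theorem mem_indepStrongBelief_of_stronglyBelieves [∀ i, Nonempty (T i)]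
    {E : ∀ i, Set (G.State T i)} {i : I} {μ : G.StratCPS obs i}
    {τ : ∀ j : {j // j ≠ i}, G.Strategy j → T j} {ω : G.State T i}
    (hω : ∀ (h : G.H i) (F : Set (G.OppState T i)),
      μ.1 h {so | (fun j => (so j, τ j (so j))) ∈ F} = 1 → (g i ω.2).1 h F = 1)
    (hτ : ∀ (j : {j // j ≠ i}) sj, sj ∈ Prod.fst '' E j → (sj, τ j sj) ∈ E j)
    (hμ : ∀ j, StronglyBelieves μ j (Prod.fst '' E j)) : ω ∈ indepStrongBelief g E i :=
  mem_indepStrongBelief_iff.2 fun j h hne => hω h _ <|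
    ProbabilityMeasure.apply_eq_one_mono (fun so hso => hτ j (so j) hso) (hμ j h hne)

end Belief

/-! ### Closedness of the events. -/

section Closed

variable [∀ i, TopologicalSpace (T i)] [∀ i, CompactSpace (T i)]
  [∀ i, TopologicalSpace.MetrizableSpace (T i)] [∀ i, BorelSpace (T i)]

theorem continuous_firstOrder (hg : ∀ i, Continuous (g i)) (i : I) :
    Continuous (firstOrder g i) :=
  Continuous.subtype_mk (continuous_pi fun h =>
    (ProbabilityMeasure.continuous_map (continuous_oppStrategies i)).comp
      ((continuous_apply h).comp (continuous_subtype_val.comp (hg i)))) _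

theorem isClosed_rational (hg : ∀ i, Continuous (g i)) (i : I) : IsClosed (rational g i) := by
  have hunion : rational g i = ⋃ si, ({si} ×ˢ {t | si ∈ bestReplies (firstOrder g i t)}) := by
    ext ⟨si, t⟩
    simp [rational]
  rw [hunion]
  exact isClosed_iUnion_of_finite fun si => isClosed_singleton.prod
    ((isClosed_setOf_mem_bestReplies si).preimage (continuous_firstOrder hg i))

theorem isClosed_restriction (hg : ∀ i, Continuous (g i)) {Δ : ∀ i, Set (G.StratCPS obs i)}
    (hΔ : ∀ i, IsCompact (Δ i)) (i : I) : IsClosed (restriction g Δ i) :=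
  (hΔ i).isClosed.preimage ((continuous_firstOrder hg i).comp continuous_snd)

theorem isClosed_indepStrongBelief (hg : ∀ i, Continuous (g i)) {E : ∀ i, Set (G.State T i)}
    (hE : ∀ i, IsClosed (E i)) (i : I) : IsClosed (indepStrongBelief g E i) :=
  isClosed_iInter fun j => isClosed_iInter fun h => isClosed_iInter fun _ =>
    (ProbabilityMeasure.isClosed_setOf_apply_eq_one
      ((hE j).preimage (continuous_apply j))).preimage
      ((continuous_apply h).comp (continuous_subtype_val.comp ((hg i).comp continuous_snd)))

theorem isClosed_csbIter (hg : ∀ i, Continuous (g i)) {E : ∀ i, Set (G.State T i)}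
    (hE : ∀ i, IsClosed (E i)) (n : ℕ) (i : I) : IsClosed (csbIter g n E i) := by
  induction n generalizing i with
  | zero => exact hE i
  | succ n ih =>
    rw [csbIter_succ]
    exact (ih i).inter (isClosed_indepStrongBelief hg ih i)

theorem isClosed_csbInf (hg : ∀ i, Continuous (g i)) {E : ∀ i, Set (G.State T i)}
    (hE : ∀ i, IsClosed (E i)) (i : I) : IsClosed (csbInf g E i) :=
  isClosed_iInter fun n => isClosed_csbIter hg hE n i

/-! ### Strategies consistent with the iterated events. -/

variable [∀ i, Nonempty (T i)]

theorem image_fst_csbInf (hg : ∀ i, Continuous (g i)) {E : ∀ i, Set (G.State T i)}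
    (hE : ∀ i, IsClosed (E i)) (i : I) :
    Prod.fst '' csbInf g E i = ⋂ n, Prod.fst '' csbIter g n E i :=
  image_fst_iInter_of_antitone (csbIter_antitone E i) fun n => isClosed_csbIter hg hE n i

theorem image_fst_csbIter_rational (hg : ∀ i, Continuous (g i))
    (hsurj : ∀ i, Function.Surjective (g i)) (n : ℕ) (i : I) :
    Prod.fst '' csbIter g n (rational g) i = G.rat obs (n + 1) i := by
  induction n using Nat.strong_induction_on generalizing i with
  | _ n ih =>
  ext si
  rw [mem_rat_succ_iff]
  constructor
  · rintro ⟨ω, hω, rfl⟩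
    obtain ⟨hrat, hbel⟩ := mem_csbIter_iff.1 hω
    refine ⟨firstOrder g i ω.2, hrat, fun j q hq => ?_⟩
    rw [← ih q hq]
    exact stronglyBelieves_of_mem_indepStrongBelief (hbel q hq) j
  · rintro ⟨μ, hμ, hbel⟩
    choose τ hτ using fun j : {j // j ≠ i} => exists_forall_mem_of_antitone
      (csbIter_antitone (g := g) (rational g) j)
      fun n => isClosed_csbIter hg (isClosed_rational hg) n j
    obtain ⟨t, rfl, ht⟩ := exists_type_of_stratCPS hsurj μ τ
    refine ⟨(si, t), mem_csbIter_iff.2 ⟨hμ, fun q hq => ?_⟩, rfl⟩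
    refine mem_indepStrongBelief_of_stronglyBelieves ht (fun j sj => hτ j sj q) fun j => ?_
    rw [ih q hq]
    exact hbel j q hq

theorem image_fst_csbInf_rational (hg : ∀ i, Continuous (g i))
    (hsurj : ∀ i, Function.Surjective (g i)) (i : I) :
    Prod.fst '' csbInf g (rational g) i = G.ratInf obs i := by
  rw [image_fst_csbInf hg (isClosed_rational hg), ratInf]
  simp only [image_fst_csbIter_rational hg hsurj]
  -- The chain decreases, so omitting its index 0 leaves the intersection unchanged.
  exact (rat_antitone i).iInf_nat_add 1

theorem image_fst_csbIter_restriction (hg : ∀ i, Continuous (g i))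
    (hsurj : ∀ i, Function.Surjective (g i)) {Δ : ∀ i, Set (G.StratCPS obs i)}
    (hΔ : ∀ i, IsCompact (Δ i)) (n : ℕ) (i : I) :
    Prod.fst '' csbIter g n (fun i => restriction g Δ i ∩ csbInf g (rational g) i) i =
      selRat Δ (n + 1) i := by
  induction n using Nat.strong_induction_on generalizing i with
  | _ n ih =>
  ext si
  rw [mem_selRat_succ_iff]
  constructor
  · rintro ⟨ω, hω, rfl⟩
    obtain ⟨⟨hres, hinf⟩, hbel⟩ := mem_csbIter_iff.1 hω
    obtain ⟨hrat, hinf⟩ := mem_csbInf_iff.1 hinf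
    have hSB : ∀ (j : {j // j ≠ i}) (q : ℕ),
        StronglyBelieves (firstOrder g i ω.2) j (G.rat obs q j) := by
      intro j q
      cases q with
      | zero =>
        rw [rat]
        exact stronglyBelieves_univ _ j
      | succ q =>
        rw [← image_fst_csbIter_rational hg hsurj q]
        exact stronglyBelieves_of_mem_indepStrongBelief (hinf q) j
    refine ⟨firstOrder g i ω.2, hres, hrat, fun j q hq => ?_, hSB⟩
    cases q with
    | zero =>
      obtain ⟨m, hm⟩ := exists_rat_eq_ratInf (G := G) (obs := obs) (j : I)
      rw [selRat]
      beta_reduce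
      rw [← hm]
      exact hSB j m
    | succ q =>
      rw [← ih q (Nat.lt_of_succ_lt_succ hq)]
      exact stronglyBelieves_of_mem_indepStrongBelief (hbel q (Nat.lt_of_succ_lt_succ hq)) j
  · rintro ⟨μ, hres, hμ, hbel, hSB⟩
    have hcl : ∀ j, IsClosed (restriction g Δ j ∩ csbInf g (rational g) j) := fun j =>
      (isClosed_restriction hg hΔ j).inter (isClosed_csbInf hg (isClosed_rational hg) j)
    have hsel : ∀ (j : {j // j ≠ i}) (sj : G.Strategy j), ∃ t : T j,
        (∀ q, sj ∈ Prod.fst '' csbIter g q (rational g) j →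
          (sj, t) ∈ csbIter g q (rational g) j) ∧
        ∀ q, sj ∈ Prod.fst ''
            csbIter g q (fun i => restriction g Δ i ∩ csbInf g (rational g) i) j →
          (sj, t) ∈ csbIter g q (fun i => restriction g Δ i ∩ csbInf g (rational g) i) j := by
      intro j sj
      by_cases h0 : sj ∈ Prod.fst '' (restriction g Δ j ∩ csbInf g (rational g) j)
      -- A type chosen for the restricted chain already lies in `CSB^∞(R)`, hence in all of the
      -- first chain. If `sj` is not in the projection of the restricted event, the second
      -- requirement is void and only the first chain matters.
      · obtain ⟨t, ht⟩ := exists_forall_mem_of_antitone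
          (csbIter_antitone (g := g) (fun i => restriction g Δ i ∩ csbInf g (rational g) i) j)
          (fun n => isClosed_csbIter hg hcl n j) sj
        exact ⟨t, fun q _ => csbInf_subset_csbIter q _ _ (ht 0 h0).2, ht⟩
      · obtain ⟨t, ht⟩ := exists_forall_mem_of_antitone
          (csbIter_antitone (g := g) (rational g) j)
          (fun n => isClosed_csbIter hg (isClosed_rational hg) n j) sj
        exact ⟨t, ht, fun q hq => absurd (image_mono (csbIter_antitone _ _ q.zero_le) hq) h0⟩
    choose τ hτ hτ' using hsel
    obtain ⟨t, rfl, ht⟩ := exists_type_of_stratCPS hsurj μ τ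
    refine ⟨(si, t), mem_csbIter_iff.2
      ⟨⟨hres, mem_csbInf_iff.2 ⟨hμ, fun q => ?_⟩⟩, fun q hq => ?_⟩, rfl⟩
    · refine mem_indepStrongBelief_of_stronglyBelieves ht (fun j sj => hτ j sj q) fun j => ?_
      rw [image_fst_csbIter_rational hg hsurj]
      exact hSB j (q + 1)
    · refine mem_indepStrongBelief_of_stronglyBelieves ht (fun j sj => hτ' j sj q) fun j => ?_
      rw [ih q hq]
      exact hbel j (q + 1) (Nat.succ_lt_succ hq)

theorem image_fst_csbInf_restriction (hg : ∀ i, Continuous (g i))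
    (hsurj : ∀ i, Function.Surjective (g i)) {Δ : ∀ i, Set (G.StratCPS obs i)}
    (hΔ : ∀ i, IsCompact (Δ i)) (i : I) :
    Prod.fst '' csbInf g (fun i => restriction g Δ i ∩ csbInf g (rational g) i) i =
      selRatInf Δ i := by
  rw [image_fst_csbInf hg fun j => (isClosed_restriction hg hΔ j).inter
    (isClosed_csbInf hg (isClosed_rational hg) j), selRatInf]
  simp only [image_fst_csbIter_restriction hg hsurj hΔ]
  refine (subset_iInter fun n => ?_).antisymm
    (subset_iInter fun n => iInter_subset _ (n + 1))
  cases n with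
  | zero =>
    -- Index 0 is missing on the left; it is recovered from `selRat Δ 1`, the projection of an event
    -- contained in `CSB^∞(R)`.
    refine (iInter_subset _ 0).trans ?_
    rw [← image_fst_csbIter_restriction hg hsurj hΔ, selRat]
    beta_reduce
    rw [← image_fst_csbInf_rational hg hsurj]
    exact image_mono inter_subset_right
  | succ n => exact iInter_subset _ n

end Closed

end TypeStructure

end DynamicGame

theorem theorem1 {I : Type u} [Finite I] [DecidableEq I]
    (G : DynamicGame.{u, v} I) (obs : Observation)
    (T : I → Type w) [∀ i, TopologicalSpace (T i)] [∀ i, CompactSpace (T i)]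
    [∀ i, TopologicalSpace.MetrizableSpace (T i)] [∀ i, Nonempty (T i)]
    [∀ i, MeasurableSpace (T i)] [∀ i, BorelSpace (T i)]
    (g : ∀ i, T i → G.StateCPS obs T i)
    (g_continuous : ∀ i, Continuous (g i)) (g_surjective : ∀ i, Function.Surjective (g i))
    (Δ : ∀ i, Set (G.StratCPS obs i)) (hΔ : ∀ i, IsCompact (Δ i)) :
    ((∀ n : ℕ, Set.pi Set.univ (DynamicGame.selRat Δ (n + 1)) =
        DynamicGame.projStrategies (DynamicGame.csbIter g n
          (fun i => DynamicGame.restriction g Δ i ∩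
            DynamicGame.csbInf g (DynamicGame.rational g) i))) ∧
      Set.pi Set.univ (DynamicGame.selRatInf Δ) =
        DynamicGame.projStrategies (DynamicGame.csbInf g
          (fun i => DynamicGame.restriction g Δ i ∩
            DynamicGame.csbInf g (DynamicGame.rational g) i))) ∧
    ((∀ n : ℕ, Set.pi Set.univ (G.rat obs (n + 1)) =
        DynamicGame.projStrategies (DynamicGame.csbIter g n (DynamicGame.rational g))) ∧
      Set.pi Set.univ (G.ratInf obs) =
        DynamicGame.projStrategies (DynamicGame.csbInf g (DynamicGame.rational g))) := by
  simp only [DynamicGame.projStrategies_eq_pi,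
    DynamicGame.image_fst_csbIter_restriction g_continuous g_surjective hΔ,
    DynamicGame.image_fst_csbInf_restriction g_continuous g_surjective hΔ,
    DynamicGame.image_fst_csbIter_rational g_continuous g_surjective,
    DynamicGame.image_fst_csbInf_rational g_continuous g_surjective,
    implies_true, and_self]
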